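/- Let $n,N_g\ge 0$ be integers and consider the continuous-time single-input single-output system $\dot x=Ax+Bu$, $y=Cx+Du$ with $x(t)\in\mathbb R^n$, where $(A,B)$ is controllable and $(C,A)$ is observable, and the signal generator $\dot w=S_gw$, $w(0)=w_0$, $u=L_gw$ with $w(t)\in\mathbb R^{N_g}$, where $(L_g,S_g)$ is observable, $(S_g,w_0)$ is controllable, and $\sigma(A)\cap\sigma(S_g)=\emptyset$ (complex spectra). For $L\in\mathbb N$ and a signal $z$, its $(L-1)$-jet at $t$ is $z_{[L]}(t)=[z(t),z^{(1)}(t),\dots,z^{(L-1)}(t)]^\top\in\mathbb R^L$. Let $\mathscr B_L^c\subseteq\mathbb R^{2L}$ be the set of all vectors $[u_{[L]}(t_0)^\top\ y_{[L]}(t_0)^\top]^\top$ for which $u$ is smooth and, for some $x$, $(u,x,y)$ satisfies the system equations in a neighborhood of $t_0$. Data $(u,y)$ on $[0,T]$ are called informative for $L$ if there are finitely many instants $t_1,\dots,t_k\in(0,T)$ such that the image of the matrix with columns $[u_{[L]}(t_j)^\top\ y_{[L]}(t_j)^\top]^\top$, $j=1,\dots,k$, equals $\mathscr B_L^c$. Write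 $\mathcal C(A,b)=[b\ Ab\ \cdots\ A^{n-1}b]$, and let $\mathcal O$ be the $N_g\times N_g$ matrix with rows $L_g,L_gS_g,\dots,L_gS_g^{N_g-1}$. Let $\Pi\in\mathbb R^{n\times N_g}$ be the solution of $A\Pi+BL_g=\Pi S_g$, for $L\le N_g$ let $\Pi_2$ consist of the last $N_g-L$ columns of $\Pi\mathcal O^{-1}$, and let $$E=\{x_0\in\mathbb R^n:\ \operatorname{rank}[\,\mathcal C(A,x_0-\Pi w_0)\ \ \Pi_2\,]<n\}.$$ Drive the system by the generator from the initial state $x(0)$ and observe $(u,y)$ on $[0,T]$, where $T>0$ is arbitrary. Then, for every $L\in\mathbb N$: (a) If $N_g<L$, the data are not informative for $L$, for any $x(0)\in\mathbb R^n$. (b) If $L\le N_g<L+n$, the set $E$ is nonempty and has Lebesgue measure zero, and the data are informative for $L$ for every $x(0)\in\mathbb R^n\setminus E$. If moreover $L\ge n$, the data are not informative for $L$ for any $x(0)\in E$. (c) If $N_g\ge L+n$, the data are informative for $L$, for every $x(0)\in\mathbb R^n$. -/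

import Mathlib

open Set Filter Topology MeasureTheory Matrix
open scoped ContDiff

namespace CTFL

/-- The `k`-step controllability matrix `[b, A b, …, A^(k-1) b]` of a pair `(A, b)`. -/
def ctrb {n : ℕ} (k : ℕ) (A : Matrix (Fin n) (Fin n) ℝ) (b : Fin n → ℝ) :
    Matrix (Fin n) (Fin k) ℝ :=
  Matrix.of fun i j => ((A ^ (j : ℕ)) *ᵥ b) i

/-- The `k`-step observability matrix of a pair `(c, A)`; its `j`-th row is `c A^j`. -/
def obsv {n : ℕ} (k : ℕ) (c : Fin n → ℝ) (A : Matrix (Fin n) (Fin n) ℝ) :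
    Matrix (Fin k) (Fin n) ℝ :=
  (ctrb k Aᵀ c)ᵀ

/-- The pair `(A, b)` is controllable. -/
def Controllable {n : ℕ} (A : Matrix (Fin n) (Fin n) ℝ) (b : Fin n → ℝ) : Prop :=
  (ctrb n A b).rank = n

/-- The pair `(c, A)` is observable. -/
def Observable {n : ℕ} (c : Fin n → ℝ) (A : Matrix (Fin n) (Fin n) ℝ) : Prop :=
  (obsv n c A).rank = n

/-- The spectrum `σ(M)` of a real square matrix: the set of its complex eigenvalues. -/
def cspec {n : ℕ} (M : Matrix (Fin n) (Fin n) ℝ) : Set ℂ :=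
  spectrum ℂ (M.map Complex.ofReal)

/-- The `(L-1)`-jet `[z(t), z'(t), …, z^(L-1)(t)]` of a signal `z` at time `t`. -/
noncomputable def jet (z : ℝ → ℝ) (L : ℕ) (t : ℝ) : Fin L → ℝ :=
  fun i => iteratedDeriv (i : ℕ) z t

/-- The stacked input–output `(L-1)`-jet at time `t`, a vector of `ℝ^(2L)`. -/
noncomputable def ioJet (u y : ℝ → ℝ) (L : ℕ) (t : ℝ) : Fin L ⊕ Fin L → ℝ :=
  Sum.elim (jet u L t) (jet y L t)

/-- The set of input–output `(L-1)`-jets of the system `x' = A x + B u`, `y = C x + D u`: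
the jets at a time `t₀` of all `(u, y)` with `u` smooth for which some `x` satisfies the
system equations in a neighbourhood of `t₀`. -/
def ioJets {n : ℕ} (A : Matrix (Fin n) (Fin n) ℝ) (B C : Fin n → ℝ) (D : ℝ) (L : ℕ) :
    Set (Fin L ⊕ Fin L → ℝ) :=
  {v | ∃ (t₀ : ℝ) (u y : ℝ → ℝ) (x : ℝ → Fin n → ℝ), ContDiff ℝ ∞ u ∧
    (∀ᶠ t in 𝓝 t₀, HasDerivAt x (A *ᵥ x t + u t • B) t ∧ y t = C ⬝ᵥ x t + D * u t) ∧
    v = ioJet u y L t₀}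

/-- The continuous-time Hankel-type matrix, whose columns are the input–output
`(L-1)`-jets at the sampling instants `τ 0, …, τ (k-1)`. -/
noncomputable def hankel (u y : ℝ → ℝ) (L : ℕ) {k : ℕ} (τ : Fin k → ℝ) :
    Matrix (Fin L ⊕ Fin L) (Fin k) ℝ :=
  Matrix.of fun i j => ioJet u y L (τ j) i

/-- The data `(u, y)` on `[0, T]` are informative for `L`: for finitely many sampling instants
in `(0, T)`, the image of the Hankel-type matrix is the set of all input–output
`(L-1)`-jets of the system. (Only the values of `u` and `y` on `[0, T]` matter here.) -/
def Informative {n : ℕ} (A : Matrix (Fin n) (Fin n) ℝ) (B C : Fin n → ℝ) (D : ℝ)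
    (L : ℕ) (T : ℝ) (u y : ℝ → ℝ) : Prop :=
  ∃ (k : ℕ) (τ : Fin k → ℝ), (∀ j, τ j ∈ Ioo 0 T) ∧
    Set.range (fun a : Fin k → ℝ => hankel u y L τ *ᵥ a) = ioJets A B C D L

/-- `(u, y)` are input–output data on `[0, T]` of the interconnection of the signal generator
`w' = Sg w`, `w(0) = w₀`, `u = Lg w` with the system `x' = A x + B u`, `y = C x + D u`
started at `x(0) = x₀`. -/
def IsData {n N : ℕ} (A : Matrix (Fin n) (Fin n) ℝ) (B C : Fin n → ℝ) (D : ℝ)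
    (Sg : Matrix (Fin N) (Fin N) ℝ) (Lg w₀ : Fin N → ℝ) (T : ℝ) (x₀ : Fin n → ℝ)
    (u y : ℝ → ℝ) : Prop :=
  ∃ (w : ℝ → Fin N → ℝ) (x : ℝ → Fin n → ℝ), w 0 = w₀ ∧ x 0 = x₀ ∧
    ∀ t ∈ Icc 0 T,
      HasDerivWithinAt w (Sg *ᵥ w t) (Icc 0 T) t ∧
      u t = Lg ⬝ᵥ w t ∧
      HasDerivWithinAt x (A *ᵥ x t + u t • B) (Icc 0 T) t ∧
      y t = C ⬝ᵥ x t + D * u t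

/-- The last `N - L` columns of an `n × N` matrix. -/
def dropCols {n N : ℕ} (L : ℕ) (M : Matrix (Fin n) (Fin N) ℝ) :
    Matrix (Fin n) (Fin (N - L)) ℝ :=
  Matrix.of fun i j => M i ⟨L + (j : ℕ), by have := j.isLt; omega⟩

/-- The exceptional set of initial states: with `Π` the solution of the Sylvester equation
`A Π + B Lg = Π Sg` and `Π₂` the last `N - L` columns of `Π O⁻¹`, where `O` is the (square)
observability matrix of `(Lg, Sg)`, it consists of those `x₀` for which the matrix
`[ctrb(A, x₀ - Π w₀), Π₂]` has rank less than `n`. -/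
def exceptionalSet {n N : ℕ} (A : Matrix (Fin n) (Fin n) ℝ) (B : Fin n → ℝ)
    (Sg : Matrix (Fin N) (Fin N) ℝ) (Lg w₀ : Fin N → ℝ) (L : ℕ) : Set (Fin n → ℝ) :=
  {x₀ | ∃ P : Matrix (Fin n) (Fin N) ℝ,
    A * P + Matrix.vecMulVec B Lg = P * Sg ∧
    (Matrix.fromCols (ctrb n A (x₀ - P *ᵥ w₀))
      (dropCols L (P * (obsv N Lg Sg)⁻¹))).rank < n}

end CTFL

/-! Sylvester's equation splits the state as `x = z + P w`, with `z' = A z` and `z 0 = x₀ - P w₀`.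
The input jet is `O_L w`, where `O_L = obsv L Lg Sg`, and the system's input–output jets form the
range of the linear map `jetMap` on pairs (state, input jet). So data are informative as soon as the
pairs `(x t, jet u L t)`, `0 < t < T`, span `ℝ^n × ℝ^L`.

Dually, let `(η, ν)` annihilate these pairs: `η z + (η P + ν O_L) w = 0` on `(0, T)`. Disjoint
spectra and controllability of `(Sg, w₀)` separate the two flows (`eq_zero_and_pow_eq_zero`): `η A^k
z 0 = 0` for all `k`, and `η P = -ν O_L`. Such an `η ≠ 0` exists exactly when `x₀` is exceptional
(`mem_exceptionalSet_iff`); if `η = 0`, observability of `(Lg, Sg)` gives `ν = 0`.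

If `L + n ≤ N`, the second condition alone forces `η = 0`, by a degree count
(`eq_zero_of_vecMul_sylvester_eq`). If `N < L`, the input jets stay in a proper subspace. If `n ≤
L`, `jetMap` is injective, so an annihilator of the pairs becomes one of the input–output jets. -/

namespace CTFL

/-! ### Cayley–Hamilton, rank conditions and the Sylvester equation -/

section Algebra

open Polynomial

variable {n N : ℕ}

theorem rank_eq_iff_vecMul {m : Type*} [Fintype m] (M : Matrix (Fin n) m ℝ) :
    M.rank = n ↔ ∀ η : Fin n → ℝ, η ᵥ* M = 0 → η = 0 := by
  have h1 : (∀ η : Fin n → ℝ, η ᵥ* M = 0 → η = 0) ↔ Function.Injective M.vecMul :=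
    (injective_iff_map_eq_zero M.vecMulLinear).symm
  rw [h1, vecMul_injective_iff, linearIndependent_iff_card_eq_finrank_span, Fintype.card_fin,
    rank_eq_finrank_span_row, eq_comm]
  rfl

theorem rank_lt_iff_vecMul {m : Type*} [Fintype m] (M : Matrix (Fin n) m ℝ) :
    M.rank < n ↔ ∃ η : Fin n → ℝ, η ≠ 0 ∧ η ᵥ* M = 0 := by
  have h : M.rank ≤ n := by simpa using M.rank_le_card_height
  rw [lt_iff_le_and_ne, and_iff_right h, Ne, rank_eq_iff_vecMul]
  push Not
  exact exists_congr fun _ => and_comm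

theorem vecMul_ctrb_apply (k : ℕ) (A : Matrix (Fin n) (Fin n) ℝ) (b η : Fin n → ℝ) (j : Fin k) :
    (η ᵥ* ctrb k A b) j = η ⬝ᵥ (A ^ (j : ℕ) *ᵥ b) := rfl

theorem obsv_mulVec_apply (k : ℕ) (c : Fin n → ℝ) (A : Matrix (Fin n) (Fin n) ℝ) (v : Fin n → ℝ)
    (j : Fin k) : (obsv k c A *ᵥ v) j = c ⬝ᵥ (A ^ (j : ℕ) *ᵥ v) := by
  rw [obsv, mulVec_transpose, vecMul_ctrb_apply, ← transpose_pow, mulVec_transpose,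
    dotProduct_mulVec, dotProduct_comm]

theorem obsv_row (k : ℕ) (c : Fin n → ℝ) (A : Matrix (Fin n) (Fin n) ℝ) (j : Fin k) :
    obsv k c A j = c ᵥ* A ^ (j : ℕ) := by
  refine dotProduct_eq _ _ fun v => ?_
  rw [← dotProduct_mulVec, ← obsv_mulVec_apply]
  rfl

theorem vecMul_obsv (k : ℕ) (c : Fin n → ℝ) (A : Matrix (Fin n) (Fin n) ℝ) (a : Fin k → ℝ) :
    a ᵥ* obsv k c A = ∑ j, a j • (c ᵥ* A ^ (j : ℕ)) := by
  rw [vecMul_eq_sum]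
  exact Finset.sum_congr rfl fun j _ => by rw [obsv_row]

/-- By Cayley–Hamilton, `A ^ k` is a combination of the powers below `n`. -/
theorem dotProduct_pow_mulVec_eq_zero (A : Matrix (Fin n) (Fin n) ℝ) (η b : Fin n → ℝ)
    (h : ∀ j < n, η ⬝ᵥ (A ^ j *ᵥ b) = 0) (k : ℕ) : η ⬝ᵥ (A ^ k *ᵥ b) = 0 := by
  rcases Nat.eq_zero_or_pos n with rfl | hn
  · simp [dotProduct]
  have hdeg : (X ^ k %ₘ A.charpoly).natDegree < n := by
    have := natDegree_modByMonic_lt (X ^ k) A.charpoly_monic (by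
      intro h1
      have := A.charpoly_natDegree_eq_dim
      rw [h1] at this
      simp at this
      omega)
    simpa using this
  rw [A.pow_eq_aeval_mod_charpoly, aeval_eq_sum_range' hdeg, sum_mulVec, dotProduct_sum]
  refine Finset.sum_eq_zero fun j hj => ?_
  rw [smul_mulVec, dotProduct_smul, h j (Finset.mem_range.1 hj), smul_zero]

theorem Controllable.eq_zero {A : Matrix (Fin n) (Fin n) ℝ} {b : Fin n → ℝ}
    (h : Controllable A b) {η : Fin n → ℝ} (hη : ∀ j < n, η ⬝ᵥ (A ^ j *ᵥ b) = 0) : η = 0 :=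
  (rank_eq_iff_vecMul _).1 h η (funext fun j => by simpa [vecMul_ctrb_apply] using hη j j.2)

theorem Observable.eq_zero_of_vecMul {A : Matrix (Fin n) (Fin n) ℝ} {c : Fin n → ℝ}
    (h : Observable c A) {a : Fin n → ℝ} (ha : a ᵥ* obsv n c A = 0) : a = 0 :=
  (rank_eq_iff_vecMul _).1 h a ha

theorem Observable.isUnit_det {A : Matrix (Fin n) (Fin n) ℝ} {c : Fin n → ℝ}
    (h : Observable c A) : IsUnit (obsv n c A).det := by
  rw [isUnit_iff_ne_zero]
  intro h0
  obtain ⟨v, hv, hv0⟩ := exists_vecMul_eq_zero_iff.2 h0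
  exact hv (h.eq_zero_of_vecMul hv0)

theorem Observable.eq_zero {A : Matrix (Fin n) (Fin n) ℝ} {c : Fin n → ℝ}
    (h : Observable c A) {v : Fin n → ℝ} (hv : ∀ j < n, c ⬝ᵥ (A ^ j *ᵥ v) = 0) : v = 0 := by
  by_contra hne
  refine h.isUnit_det.ne_zero (exists_mulVec_eq_zero_iff.1 ⟨v, hne, funext fun j => ?_⟩)
  rw [obsv_mulVec_apply, hv j j.2, Pi.zero_apply]

/-- The coefficients of `r` are coordinates with respect to the independent rows `l S^j`, `j < N`.
Bounding the degree through coefficients also covers `N = 0`. -/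
theorem Observable.polynomial_eq_zero {S : Matrix (Fin N) (Fin N) ℝ} {l : Fin N → ℝ}
    (h : Observable l S) {r : ℝ[X]} (hr : ∀ i, N ≤ i → r.coeff i = 0)
    (h0 : l ᵥ* aeval S r = 0) : r = 0 := by
  have hdeg : r.natDegree < N + 1 := Nat.lt_succ_of_le
    (natDegree_le_iff_coeff_eq_zero.2 fun i hi => hr i hi.le)
  rw [aeval_eq_sum_range' hdeg, Finset.sum_range_succ, hr N le_rfl, zero_smul, add_zero,
    vecMul_sum] at h0
  have h1 : (fun j : Fin N => r.coeff j) = 0 := by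
    refine h.eq_zero_of_vecMul ?_
    rw [vecMul_obsv, ← h0, Finset.sum_range]
    exact Finset.sum_congr rfl fun j _ => (vecMul_smul _ _ _).symm
  ext i
  rcases lt_or_ge i N with hi | hi
  · simpa using congrFun h1 ⟨i, hi⟩
  · simp [hr i hi]

theorem isCoprime_charpoly_of_cspec_disjoint {A : Matrix (Fin n) (Fin n) ℝ}
    {S : Matrix (Fin N) (Fin N) ℝ} (h : cspec A ∩ cspec S = ∅) :
    IsCoprime A.charpoly S.charpoly := by
  rw [isCoprime_iff_aeval_ne_zero_of_isAlgClosed ℝ ℂ]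
  intro z
  by_contra! hz
  have hmem : ∀ {m : ℕ} (M : Matrix (Fin m) (Fin m) ℝ), aeval z M.charpoly = 0 → z ∈ cspec M := by
    intro m M hM
    have h1 : (M.map Complex.ofReal).charpoly = M.charpoly.map Complex.ofRealHom :=
      M.charpoly_map Complex.ofRealHom
    rw [cspec, mem_spectrum_iff_isRoot_charpoly, h1, IsRoot.def, eval_map]
    exact hM
  exact notMem_empty z (h ▸ ⟨hmem A hz.1, hmem S hz.2⟩)

/-- Evaluate a Bézout identity for the two characteristic polynomials at `S`; Cayley–Hamilton kills
the `S` term. -/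
theorem isUnit_aeval_charpoly_of_cspec_disjoint {A : Matrix (Fin n) (Fin n) ℝ}
    {S : Matrix (Fin N) (Fin N) ℝ} (h : cspec A ∩ cspec S = ∅) :
    IsUnit (aeval S A.charpoly) := by
  obtain ⟨a, b, hab⟩ := isCoprime_charpoly_of_cspec_disjoint h
  have h1 := congrArg (aeval S) hab
  rw [map_add, map_mul, map_mul, aeval_self_charpoly, mul_zero, add_zero, map_one] at h1
  exact IsUnit.of_mul_eq_one_right _ h1

theorem mul_aeval_of_mul_eq {A : Matrix (Fin n) (Fin n) ℝ} {S : Matrix (Fin N) (Fin N) ℝ}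
    {P : Matrix (Fin n) (Fin N) ℝ} (h : A * P = P * S) (p : ℝ[X]) :
    aeval A p * P = P * aeval S p := by
  have hpow : ∀ k : ℕ, A ^ k * P = P * S ^ k := by
    intro k
    induction k with
    | zero => simp
    | succ k ih =>
      rw [pow_succ, Matrix.mul_assoc, h, ← Matrix.mul_assoc, ih, Matrix.mul_assoc, ← pow_succ]
  rw [aeval_eq_sum_range, aeval_eq_sum_range, Matrix.sum_mul, Matrix.mul_sum]
  refine Finset.sum_congr rfl fun k _ => ?_
  rw [Matrix.smul_mul, Matrix.mul_smul, hpow]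

/-- With `χ` the characteristic polynomial of `A`, intertwining gives `0 = χ(A) P = P χ(S)`, and
`χ(S)` is invertible. -/
theorem eq_zero_of_mul_eq_of_cspec_disjoint {A : Matrix (Fin n) (Fin n) ℝ}
    {S : Matrix (Fin N) (Fin N) ℝ} (hσ : cspec A ∩ cspec S = ∅)
    {P : Matrix (Fin n) (Fin N) ℝ} (h : A * P = P * S) : P = 0 := by
  have h1 := mul_aeval_of_mul_eq h A.charpoly
  rw [aeval_self_charpoly, Matrix.zero_mul] at h1
  have h2 := (isUnit_iff_isUnit_det _).1 (isUnit_aeval_charpoly_of_cspec_disjoint hσ)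
  rw [← Matrix.mul_one P, ← mul_nonsing_inv _ h2, ← Matrix.mul_assoc, ← h1, Matrix.zero_mul]

/-- The Sylvester equation of matrices with disjoint spectra is uniquely solvable. -/
theorem existsUnique_sylvester {A : Matrix (Fin n) (Fin n) ℝ}
    {S : Matrix (Fin N) (Fin N) ℝ} (hσ : cspec A ∩ cspec S = ∅) (Q : Matrix (Fin n) (Fin N) ℝ) :
    ∃! P : Matrix (Fin n) (Fin N) ℝ, A * P + Q = P * S := by
  let T : Matrix (Fin n) (Fin N) ℝ →ₗ[ℝ] Matrix (Fin n) (Fin N) ℝ :=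
    { toFun := fun P => P * S - A * P
      map_add' := fun P R => by rw [Matrix.add_mul, Matrix.mul_add]; abel
      map_smul' := fun c P => by
        rw [Matrix.smul_mul, Matrix.mul_smul, ← smul_sub, RingHom.id_apply] }
  have hT : Function.Injective T := (injective_iff_map_eq_zero T).2 fun P hP =>
    eq_zero_of_mul_eq_of_cspec_disjoint hσ (sub_eq_zero.1 hP).symm
  have key : ∀ P, A * P + Q = P * S ↔ T P = Q := fun P =>
    ⟨fun h => sub_eq_of_eq_add' h.symm, fun h => (eq_add_of_sub_eq' h).symm⟩
  simp only [key]
  exact Function.bijective_iff_existsUnique T |>.1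
    ⟨hT, LinearMap.injective_iff_surjective.1 hT⟩ Q

/-- The polynomials `a_k` with `η A^k P = l a_k(S)` for a solution `P` of the Sylvester equation,
started at `a_0 = a`. -/
noncomputable def sylvesterPoly (h : ℕ → ℝ) (a : ℝ[X]) : ℕ → ℝ[X]
  | 0 => a
  | k + 1 => X * sylvesterPoly h a k - C (h k)

theorem coeff_sylvesterPoly (h : ℕ → ℝ) {a : ℝ[X]} {L : ℕ} (ha : ∀ i, L ≤ i → a.coeff i = 0)
    (k : ℕ) : ∀ i, L + k ≤ i → (sylvesterPoly h a k).coeff i = 0 := by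
  induction k with
  | zero => exact ha
  | succ k ih =>
    intro i hi
    obtain ⟨i, rfl⟩ : ∃ j, i = j + 1 := ⟨i - 1, by omega⟩
    rw [sylvesterPoly, coeff_sub, coeff_X_mul, ih i (by omega), coeff_C_succ, sub_zero]

/-- Multiplying a nonzero polynomial by `X` makes its degree positive, so subtracting a constant
cannot lower it: once nonzero, the sequence gains one degree per step. -/
theorem degree_sylvesterPoly (h : ℕ → ℝ) (a : ℝ[X]) {k : ℕ} (hk : sylvesterPoly h a k ≠ 0)
    (m : ℕ) : (sylvesterPoly h a (k + m)).degree =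
      (((sylvesterPoly h a k).natDegree + m : ℕ) : WithBot ℕ) := by
  induction m with
  | zero => exact degree_eq_natDegree hk
  | succ m ih =>
    have h1 : (X * sylvesterPoly h a (k + m)).degree =
        (((sylvesterPoly h a k).natDegree + (m + 1) : ℕ) : WithBot ℕ) := by
      rw [degree_mul, ih, degree_X, add_comm, ← Nat.cast_one (R := WithBot ℕ), ← Nat.cast_add]
      rfl
    rw [← add_assoc, sylvesterPoly, degree_sub_C, h1]
    rw [h1]
    exact_mod_cast Nat.succ_pos _

/-- Sylvester's equation gives `A^(k+1) P = A^k P S - (A^k B) l`, which is the recursion of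
`sylvesterPoly` read through `l`. -/
theorem vecMul_pow_vecMul_sylvester {A : Matrix (Fin n) (Fin n) ℝ} {B : Fin n → ℝ}
    {S : Matrix (Fin N) (Fin N) ℝ} {l : Fin N → ℝ} {P : Matrix (Fin n) (Fin N) ℝ}
    (hP : A * P + vecMulVec B l = P * S) {η : Fin n → ℝ} {a : ℝ[X]}
    (ha : η ᵥ* P = l ᵥ* aeval S a) (k : ℕ) :
    η ᵥ* (A ^ k * P) = l ᵥ* aeval S (sylvesterPoly (fun j => η ⬝ᵥ (A ^ j *ᵥ B)) a k) := by
  induction k with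
  | zero => simpa [sylvesterPoly] using ha
  | succ k ih =>
    have h1 : A ^ (k + 1) * P = A ^ k * P * S - A ^ k * vecMulVec B l := by
      rw [pow_succ, Matrix.mul_assoc, eq_sub_of_add_eq hP, Matrix.mul_sub, Matrix.mul_assoc]
    rw [h1, vecMul_sub, ← vecMul_vecMul, ih, sylvesterPoly, map_sub, vecMul_sub, mul_comm X,
      map_mul, aeval_X, ← vecMul_vecMul, aeval_C, ← vecMul_vecMul, vecMul_vecMulVec,
      Algebra.algebraMap_eq_smul_one, vecMul_smul, vecMul_one, dotProduct_mulVec]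

/-- If `(A, B)` is controllable, `(l, S)` observable, and a row combination of the solution `P` of
the Sylvester equation is `l a(S)` with `deg a < L` and `L + n ≤ N`, then it is trivial. -/
theorem eq_zero_of_vecMul_sylvester_eq {A : Matrix (Fin n) (Fin n) ℝ} {B : Fin n → ℝ}
    {S : Matrix (Fin N) (Fin N) ℝ} {l : Fin N → ℝ} {P : Matrix (Fin n) (Fin N) ℝ}
    (hAB : Controllable A B) (hlS : Observable l S)
    (hP : A * P + vecMulVec B l = P * S) {η : Fin n → ℝ} {a : ℝ[X]} {L : ℕ} (hL : L + n ≤ N)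
    (hdeg : ∀ i, L ≤ i → a.coeff i = 0) (ha : η ᵥ* P = l ᵥ* aeval S a) : η = 0 := by
  set q := sylvesterPoly (fun j => η ⬝ᵥ (A ^ j *ᵥ B)) a with hq
  -- Cayley–Hamilton for `A`, transported to polynomials: each `q k` with `k ≤ n` has degree below
  -- `L + n ≤ N`, where `r ↦ l r(S)` is injective.
  have hsum : ∑ k ∈ Finset.range (n + 1), A.charpoly.coeff k • q k = 0 := by
    refine hlS.polynomial_eq_zero (fun i hi => ?_) ?_
    · rw [finsetSum_coeff]
      refine Finset.sum_eq_zero fun k hk => ?_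
      rw [coeff_smul, coeff_sylvesterPoly _ hdeg k i (by
        have := Finset.mem_range.1 hk
        omega), smul_zero]
    · have h1 : aeval A A.charpoly = ∑ k ∈ Finset.range (n + 1), A.charpoly.coeff k • A ^ k := by
        rw [aeval_eq_sum_range]
        simp
      have h2 : η ᵥ* (aeval A A.charpoly * P) = 0 := by
        rw [aeval_self_charpoly, Matrix.zero_mul, vecMul_zero]
      rw [← h2, h1, Matrix.sum_mul, vecMul_sum, map_sum, vecMul_sum]
      refine Finset.sum_congr rfl fun k _ => ?_
      rw [map_smul, vecMul_smul, Matrix.smul_mul, vecMul_smul, vecMul_pow_vecMul_sylvester hP ha]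
  -- The characteristic polynomial is monic, so a nonzero `q n` would have strictly the largest
  -- degree in the sum and could not cancel.
  have hqn : q n = 0 := by
    by_contra hne
    have hc : A.charpoly.coeff n = 1 := by
      have := A.charpoly_monic
      rwa [Monic, leadingCoeff, charpoly_natDegree_eq_dim, Fintype.card_fin] at this
    rw [Finset.sum_range_succ, hc, one_smul] at hsum
    have hlt : (∑ k ∈ Finset.range n, A.charpoly.coeff k • q k).degree < (q n).degree := by
      refine (degree_sum_le _ _).trans_lt ((Finset.sup_lt_iff (bot_lt_iff_ne_bot.2
        (degree_ne_bot.2 hne))).2 fun k hk => (degree_smul_le _ _).trans_lt ?_)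
      obtain ⟨m, hm⟩ := Nat.exists_eq_add_of_lt (Finset.mem_range.1 hk)
      by_cases hk0 : q k = 0
      · rw [hk0, degree_zero]
        exact bot_lt_iff_ne_bot.2 (degree_ne_bot.2 hne)
      · have := degree_sylvesterPoly _ _ hk0 (m + 1)
        rw [← add_assoc, ← hm] at this
        rw [degree_eq_natDegree hk0, hq, this]
        exact_mod_cast Nat.lt_add_of_pos_right (Nat.succ_pos m)
    rw [eq_neg_of_add_eq_zero_left hsum, degree_neg] at hlt
    exact lt_irrefl _ hlt
  have hq0 : ∀ k ≤ n, q k = 0 := by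
    intro k hk
    by_contra hne
    obtain ⟨m, rfl⟩ := Nat.exists_eq_add_of_le hk
    have := degree_sylvesterPoly _ _ hne m
    rw [← hq, hqn, degree_zero] at this
    exact absurd this.symm (WithBot.natCast_ne_bot _)
  refine hAB.eq_zero fun j hj => ?_
  -- With two consecutive terms zero, the recursion leaves only the constant `η A^j B`.
  have h1 : q (j + 1) = X * q j - C (η ⬝ᵥ (A ^ j *ᵥ B)) := rfl
  rw [hq0 _ hj, hq0 _ hj.le, mul_zero, zero_sub, eq_comm, neg_eq_zero, C_eq_zero] at h1
  exact h1

end Algebra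

end CTFL

namespace CTFL

/-! ### Linear flows and their annihilators -/

section Analysis

variable {n N : ℕ}

theorem hasDerivWithinAt_linearMap {E F : Type*} [NormedAddCommGroup E] [NormedSpace ℝ E]
    [FiniteDimensional ℝ E] [NormedAddCommGroup F] [NormedSpace ℝ F] (φ : E →ₗ[ℝ] F)
    {x : ℝ → E} {x' : E} {s : Set ℝ} {t : ℝ} (h : HasDerivWithinAt x x' s t) :
    HasDerivWithinAt (fun t => φ (x t)) (φ x') s t :=
  φ.toContinuousLinearMap.hasFDerivAt.comp_hasDerivWithinAt t h

theorem hasDerivAt_linearMap {E F : Type*} [NormedAddCommGroup E] [NormedSpace ℝ E]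
    [FiniteDimensional ℝ E] [NormedAddCommGroup F] [NormedSpace ℝ F] (φ : E →ₗ[ℝ] F)
    {x : ℝ → E} {x' : E} {t : ℝ} (h : HasDerivAt x x' t) :
    HasDerivAt (fun t => φ (x t)) (φ x') t :=
  φ.toContinuousLinearMap.hasFDerivAt.comp_hasDerivAt t h

theorem hasDerivWithinAt_dotProduct (c : Fin n → ℝ) {x : ℝ → Fin n → ℝ} {x' : Fin n → ℝ}
    {s : Set ℝ} {t : ℝ} (h : HasDerivWithinAt x x' s t) :
    HasDerivWithinAt (fun t => c ⬝ᵥ x t) (c ⬝ᵥ x') s t :=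
  hasDerivWithinAt_linearMap (dotProductBilin ℝ ℝ c) h

theorem hasDerivAt_dotProduct (c : Fin n → ℝ) {x : ℝ → Fin n → ℝ} {x' : Fin n → ℝ}
    {t : ℝ} (h : HasDerivAt x x' t) :
    HasDerivAt (fun t => c ⬝ᵥ x t) (c ⬝ᵥ x') t :=
  hasDerivAt_linearMap (dotProductBilin ℝ ℝ c) h

/-- Variation of constants: the state equation is solvable for every continuous input. -/
theorem exists_state (A : Matrix (Fin n) (Fin n) ℝ) (B : Fin n → ℝ) {u : ℝ → ℝ}
    (hu : Continuous u) (x₀ : Fin n → ℝ) :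
    ∃ x : ℝ → Fin n → ℝ, x 0 = x₀ ∧ ∀ t, HasDerivAt x (A *ᵥ x t + u t • B) t := by
  let F : (Fin n → ℝ) →L[ℝ] (Fin n → ℝ) := A.mulVecLin.toContinuousLinearMap
  let e : ℝ → ((Fin n → ℝ) →L[ℝ] (Fin n → ℝ)) := fun t => NormedSpace.exp (t • F)
  have he : ∀ t, HasDerivAt e (F * e t) t := fun t => hasDerivAt_exp_smul_const' F t
  have hc : Continuous e := continuous_iff_continuousAt.2 fun t => (he t).continuousAt
  have hinv : ∀ t v, e t (e (-t) v) = v := by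
    intro t v
    have : e t * e (-t) = 1 := by
      have hcomm : Commute (t • F) ((-t) • F) := ((Commute.refl F).smul_left t).smul_right (-t)
      let _ : NormedAlgebra ℚ ((Fin n → ℝ) →L[ℝ] (Fin n → ℝ)) := NormedAlgebra.restrictScalars ℚ ℝ _
      change NormedSpace.exp (t • F) * NormedSpace.exp ((-t) • F) = 1
      rw [← NormedSpace.exp_add_of_commute hcomm, ← add_smul, add_neg_cancel, zero_smul,
        NormedSpace.exp_zero]
    exact congrArg (fun G : (Fin n → ℝ) →L[ℝ] (Fin n → ℝ) => G v) this
  have hg : Continuous fun s => e (-s) (u s • B) :=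
    (hc.comp continuous_neg).clm_apply (hu.smul continuous_const)
  refine ⟨fun t => e t (x₀ + ∫ s in (0 : ℝ)..t, e (-s) (u s • B)), ?_, fun t => ?_⟩
  · simp [e]
  · have h1 := (he t).clm_apply
      ((hg.integral_hasStrictDerivAt 0 t).hasDerivAt.const_add x₀)
    rw [hinv] at h1
    exact h1

/-- Uniqueness for the ODE gives `z t = exp (t A) (z 0)`, and `η` kills every term of the
exponential series. -/
theorem dotProduct_eq_zero_of_hasDerivWithinAt (A : Matrix (Fin n) (Fin n) ℝ) {T : ℝ}
    {z : ℝ → Fin n → ℝ} (hz : ∀ t ∈ Icc 0 T, HasDerivWithinAt z (A *ᵥ z t) (Icc 0 T) t)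
    {η : Fin n → ℝ} (hη : ∀ k, η ⬝ᵥ (A ^ k *ᵥ z 0) = 0) :
    ∀ t ∈ Icc 0 T, η ⬝ᵥ z t = 0 := by
  let F : (Fin n → ℝ) →L[ℝ] (Fin n → ℝ) := A.mulVecLin.toContinuousLinearMap
  let e : ℝ → ((Fin n → ℝ) →L[ℝ] (Fin n → ℝ)) := fun t => NormedSpace.exp (t • F)
  have he : ∀ t, HasDerivAt (fun t => e t (z 0)) (F (e t (z 0))) t := fun t => by
    simpa using (hasDerivAt_exp_smul_const' F t).clm_apply (hasDerivAt_const t (z 0))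
  have hzc : ContinuousOn z (Icc 0 T) := fun t ht => (hz t ht).continuousWithinAt
  have heq : EqOn z (fun t => e t (z 0)) (Icc 0 T) := by
    refine ODE_solution_unique (v := fun _ => F) (fun _ => F.lipschitz) hzc (fun t ht => ?_)
      (fun t _ => (he t).continuousAt.continuousWithinAt) (fun t _ => (he t).hasDerivWithinAt) ?_
    · exact (hz t (Ico_subset_Icc_self ht)).mono_of_mem_nhdsWithin (Icc_mem_nhdsGE_of_mem ht)
    · simp [e]
  have hpow : ∀ k v, (F ^ k) v = A ^ k *ᵥ v := by
    intro k
    induction k with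
    | zero => intro v; simp
    | succ k ih =>
      intro v
      rw [pow_succ, pow_succ, ← mulVec_mulVec, ← ih]
      rfl
  intro t ht
  rw [heq ht]
  have hsum := NormedSpace.exp_series_hasSum_exp' (𝕂 := ℝ) (t • F)
  let φ : ((Fin n → ℝ) →L[ℝ] (Fin n → ℝ)) →L[ℝ] ℝ :=
    ((dotProductBilin ℝ ℝ η).toContinuousLinearMap).comp
      (ContinuousLinearMap.apply ℝ (Fin n → ℝ) (z 0))
  have h1 := hsum.mapL φ
  have h2 : (fun k : ℕ => φ ((k.factorial⁻¹ : ℝ) • (t • F) ^ k)) = fun _ => 0 := by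
    funext k
    rw [smul_pow, map_smul, map_smul]
    have : φ (F ^ k) = η ⬝ᵥ (A ^ k *ᵥ z 0) := congrArg (η ⬝ᵥ ·) (hpow k (z 0))
    rw [this, hη, smul_zero, smul_zero]
  rw [h2] at h1
  exact h1.unique hasSum_zero

/-- Two linear flows annihilated by a functional on `(0, T)` have their Krylov sequences
annihilated by it at time `0`. -/
theorem dotProduct_pow_add_eq_zero (A : Matrix (Fin n) (Fin n) ℝ) (S : Matrix (Fin N) (Fin N) ℝ)
    {T : ℝ} (hT : 0 < T) {z : ℝ → Fin n → ℝ} {w : ℝ → Fin N → ℝ}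
    (hz : ∀ t ∈ Icc 0 T, HasDerivWithinAt z (A *ᵥ z t) (Icc 0 T) t)
    (hw : ∀ t ∈ Icc 0 T, HasDerivWithinAt w (S *ᵥ w t) (Icc 0 T) t) (k : ℕ) :
    ∀ (η : Fin n → ℝ) (μ : Fin N → ℝ), (∀ t ∈ Ioo 0 T, η ⬝ᵥ z t + μ ⬝ᵥ w t = 0) →
      η ⬝ᵥ (A ^ k *ᵥ z 0) + μ ⬝ᵥ (S ^ k *ᵥ w 0) = 0 := by
  have hder : ∀ (η : Fin n → ℝ) (μ : Fin N → ℝ), ∀ t ∈ Icc 0 T,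
      HasDerivWithinAt (fun t => η ⬝ᵥ z t + μ ⬝ᵥ w t)
        (η ⬝ᵥ (A *ᵥ z t) + μ ⬝ᵥ (S *ᵥ w t)) (Icc 0 T) t := fun η μ t ht =>
    (hasDerivWithinAt_dotProduct η (hz t ht)).add (hasDerivWithinAt_dotProduct μ (hw t ht))
  induction k with
  | zero =>
    intro η μ h
    have hc : ContinuousOn (fun t => η ⬝ᵥ z t + μ ⬝ᵥ w t) (Icc 0 T) :=
      fun t ht => (hder η μ t ht).continuousWithinAt
    -- The relation passes from the open interval to its endpoint `0` by continuity.
    have := (show EqOn (fun t => η ⬝ᵥ z t + μ ⬝ᵥ w t) (fun _ => 0) (Ioo 0 T) from h).of_subset_closure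
      hc continuousOn_const Ioo_subset_Icc_self (closure_Ioo hT.ne).ge (left_mem_Icc.2 hT.le)
    simpa using this
  | succ k ih =>
    intro η μ h
    -- Differentiating the relation on the open interval yields the same relation for `η A` and `μ
    -- S`.
    have := ih (η ᵥ* A) (μ ᵥ* S) fun t ht => by
      have h1 := (hder η μ t (Ioo_subset_Icc_self ht)).hasDerivAt (Icc_mem_nhds ht.1 ht.2)
      have h2 : (fun t => η ⬝ᵥ z t + μ ⬝ᵥ w t) =ᶠ[𝓝 t] fun _ => 0 :=
        Filter.eventuallyEq_of_mem (Ioo_mem_nhds ht.1 ht.2) h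
      rw [← dotProduct_mulVec, ← dotProduct_mulVec]
      exact (h1.congr_of_eventuallyEq h2.symm).unique (hasDerivAt_const t 0)
    rwa [← dotProduct_mulVec, ← dotProduct_mulVec, mulVec_mulVec, mulVec_mulVec, ← pow_succ',
      ← pow_succ'] at this

/-- If the spectra are disjoint and the second flow is controllable, then annihilation of the joint
flow splits. -/
theorem eq_zero_and_pow_eq_zero {A : Matrix (Fin n) (Fin n) ℝ} {S : Matrix (Fin N) (Fin N) ℝ}
    (hσ : cspec A ∩ cspec S = ∅) {T : ℝ} (hT : 0 < T) {z : ℝ → Fin n → ℝ} {w : ℝ → Fin N → ℝ}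
    (hz : ∀ t ∈ Icc 0 T, HasDerivWithinAt z (A *ᵥ z t) (Icc 0 T) t)
    (hw : ∀ t ∈ Icc 0 T, HasDerivWithinAt w (S *ᵥ w t) (Icc 0 T) t)
    (hSw : Controllable S (w 0)) {η : Fin n → ℝ} {μ : Fin N → ℝ}
    (h : ∀ t ∈ Ioo 0 T, η ⬝ᵥ z t + μ ⬝ᵥ w t = 0) :
    μ = 0 ∧ ∀ k, η ⬝ᵥ (A ^ k *ᵥ z 0) = 0 := by
  have h0 := fun k => dotProduct_pow_add_eq_zero A S hT hz hw k η μ h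
  have hp : ∀ p : Polynomial ℝ, η ⬝ᵥ (Polynomial.aeval A p *ᵥ z 0) +
      μ ⬝ᵥ (Polynomial.aeval S p *ᵥ w 0) = 0 := by
    intro p
    rw [Polynomial.aeval_eq_sum_range, Polynomial.aeval_eq_sum_range, sum_mulVec, sum_mulVec,
      dotProduct_sum, dotProduct_sum, ← Finset.sum_add_distrib]
    refine Finset.sum_eq_zero fun k _ => ?_
    rw [smul_mulVec, smul_mulVec, dotProduct_smul, dotProduct_smul, ← smul_add, h0, smul_zero]
  have h1 : μ ᵥ* Polynomial.aeval S A.charpoly = 0 := by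
    refine hSw.eq_zero fun k _ => ?_
    -- This polynomial vanishes at `A`, so only the `w` term survives, and controllability of `(S, w
    -- 0)` applies to it.
    have := hp (A.charpoly * Polynomial.X ^ k)
    rwa [map_mul, map_mul, aeval_self_charpoly, Matrix.zero_mul, zero_mulVec, dotProduct_zero,
      zero_add, map_pow, Polynomial.aeval_X, ← mulVec_mulVec, dotProduct_mulVec] at this
  have h2 : μ = 0 := by
    have h3 := vecMul_injective_iff_isUnit.2 (isUnit_aeval_charpoly_of_cspec_disjoint hσ)
    exact h3 (h1.trans (zero_vecMul _).symm)
  refine ⟨h2, fun k => ?_⟩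
  simpa [h2] using h0 k

/-- The Taylor polynomial with derivatives `v i` at `0` serves. -/
theorem exists_smooth_jet (L : ℕ) (v : Fin L → ℝ) :
    ∃ u : ℝ → ℝ, ContDiff ℝ ∞ u ∧ jet u L 0 = v := by
  let p : Polynomial ℝ := ∑ i : Fin L, Polynomial.monomial (i : ℕ) (v i / (i : ℕ).factorial)
  have hp : ∀ i : Fin L, p.coeff i = v i / (i : ℕ).factorial := by
    intro i
    simp only [p, Polynomial.finsetSum_coeff, Polynomial.coeff_monomial, Fin.val_inj]
    simp
  have hd : ∀ (k : ℕ) (q : Polynomial ℝ), iteratedDeriv k (fun t => q.eval t) =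
      fun t => (Polynomial.derivative^[k] q).eval t := by
    intro k
    induction k with
    | zero => intro q; simp
    | succ k ih =>
      intro q
      rw [iteratedDeriv_succ', Function.iterate_succ_apply, ← ih]
      congr 1
      funext t
      exact q.deriv
  refine ⟨fun t => p.eval t, by simpa using p.contDiff_aeval (𝕜 := ℝ) ∞, funext fun i => ?_⟩
  rw [jet, hd]
  change Polynomial.eval 0 _ = _
  rw [← Polynomial.coeff_zero_eq_eval_zero, Polynomial.coeff_iterate_derivative, zero_add, hp,
    Nat.descFactorial_self, nsmul_eq_mul]
  field_simp

end Analysis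

end CTFL

namespace CTFL

/-! ### Input–output jets as a linear image of state and input jet -/

section Jets

variable {n N : ℕ}

/-- The `i`-th derivative of the state, as a linear function of the state and of the
`(L-1)`-jet of the input (for `i ≤ L`). -/
noncomputable def stateJet (A : Matrix (Fin n) (Fin n) ℝ) (B : Fin n → ℝ) (L : ℕ) :
    ℕ → ((Fin n → ℝ) × (Fin L → ℝ) →ₗ[ℝ] (Fin n → ℝ))
  | 0 => LinearMap.fst ℝ _ _
  | i + 1 => A.mulVecLin ∘ₗ stateJet A B L i +
      (if h : i < L then LinearMap.proj ⟨i, h⟩ ∘ₗ LinearMap.snd ℝ _ _ else 0).smulRight B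

/-- The map taking the state and the input jet at some time to the input–output jet. -/
noncomputable def jetMap (A : Matrix (Fin n) (Fin n) ℝ) (B C : Fin n → ℝ) (D : ℝ) (L : ℕ) :
    (Fin n → ℝ) × (Fin L → ℝ) →ₗ[ℝ] (Fin L ⊕ Fin L → ℝ) :=
  LinearMap.pi (Sum.elim (fun i => LinearMap.proj i ∘ₗ LinearMap.snd ℝ _ _)
    fun i => dotProductBilin ℝ ℝ C ∘ₗ stateJet A B L i +
      D • (LinearMap.proj i ∘ₗ LinearMap.snd ℝ _ _))

theorem stateJet_succ_apply (A : Matrix (Fin n) (Fin n) ℝ) (B : Fin n → ℝ) {L i : ℕ} (h : i < L)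
    (p : (Fin n → ℝ) × (Fin L → ℝ)) :
    stateJet A B L (i + 1) p = A *ᵥ stateJet A B L i p + p.2 ⟨i, h⟩ • B := by
  simp [stateJet, h]

theorem jetMap_inl (A : Matrix (Fin n) (Fin n) ℝ) (B C : Fin n → ℝ) (D : ℝ) {L : ℕ}
    (p : (Fin n → ℝ) × (Fin L → ℝ)) (i : Fin L) : jetMap A B C D L p (Sum.inl i) = p.2 i := rfl

theorem jetMap_inr (A : Matrix (Fin n) (Fin n) ℝ) (B C : Fin n → ℝ) (D : ℝ) {L : ℕ}
    (p : (Fin n → ℝ) × (Fin L → ℝ)) (i : Fin L) :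
    jetMap A B C D L p (Sum.inr i) = C ⬝ᵥ stateJet A B L i p + D * p.2 i := rfl

/-- The first half of the image is the input jet itself. When it vanishes, the output part is `C A^i
x`, `i < L`, which contains all the rows of the observability matrix since `n ≤ L`. -/
theorem jetMap_injective {A : Matrix (Fin n) (Fin n) ℝ} (B : Fin n → ℝ) {C : Fin n → ℝ} (D : ℝ)
    {L : ℕ} (hCA : Observable C A) (hL : n ≤ L) : Function.Injective (jetMap A B C D L) := by
  refine (injective_iff_map_eq_zero _).2 fun p hp => ?_
  have h2 : p.2 = 0 := funext fun i => by
    simpa [jetMap_inl] using congrFun hp (Sum.inl i)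
  have hst : ∀ i ≤ L, stateJet A B L i p = A ^ i *ᵥ p.1 := by
    intro i
    induction i with
    | zero => intro _; simp [stateJet]
    | succ i ih =>
      intro hi
      rw [stateJet_succ_apply A B hi, ih (by omega), h2, mulVec_mulVec, ← pow_succ']
      simp
  have h1 : p.1 = 0 := hCA.eq_zero fun j hj => by
    have h3 := congrFun hp (Sum.inr ⟨j, hj.trans_le hL⟩)
    rw [jetMap_inr, h2] at h3
    simpa [hst j (hj.le.trans hL)] using h3
  exact Prod.ext h1 h2

theorem hasDerivAt_stateJet {A : Matrix (Fin n) (Fin n) ℝ} {B : Fin n → ℝ} {L : ℕ} {u : ℝ → ℝ}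
    {x : ℝ → Fin n → ℝ} {t : ℝ} (hu : ∀ k, DifferentiableAt ℝ (iteratedDeriv k u) t)
    (hx : HasDerivAt x (A *ᵥ x t + u t • B) t) :
    ∀ i < L, HasDerivAt (fun t => stateJet A B L i (x t, jet u L t))
      (stateJet A B L (i + 1) (x t, jet u L t)) t := by
  intro i
  induction i with
  | zero =>
    intro hi
    rw [stateJet_succ_apply A B hi]
    exact hx
  | succ i ih =>
    intro hi
    have h1 : (fun t => stateJet A B L (i + 1) (x t, jet u L t)) = fun t =>
        A *ᵥ stateJet A B L i (x t, jet u L t) + iteratedDeriv i u t • B := funext fun s =>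
      stateJet_succ_apply A B (Nat.lt_of_succ_lt hi) _
    rw [h1, stateJet_succ_apply A B hi]
    refine (hasDerivAt_linearMap A.mulVecLin (ih (Nat.lt_of_succ_lt hi))).add ?_
    have h2 := (hu i).hasDerivAt
    rw [← iteratedDeriv_succ] at h2
    exact h2.smul_const B

/-- Openness of `U` lets the formula for each output derivative be differentiated again. -/
theorem ioJet_eq_jetMap {A : Matrix (Fin n) (Fin n) ℝ} {B C : Fin n → ℝ} {D : ℝ} (L : ℕ)
    {u y : ℝ → ℝ} {x : ℝ → Fin n → ℝ} {U : Set ℝ} (hU : IsOpen U)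
    (hu : ∀ k, ∀ t ∈ U, DifferentiableAt ℝ (iteratedDeriv k u) t)
    (hx : ∀ t ∈ U, HasDerivAt x (A *ᵥ x t + u t • B) t)
    (hy : ∀ t ∈ U, y t = C ⬝ᵥ x t + D * u t) :
    ∀ t ∈ U, ioJet u y L t = jetMap A B C D L (x t, jet u L t) := by
  have key : ∀ i < L, ∀ t ∈ U, iteratedDeriv i y t =
      C ⬝ᵥ stateJet A B L i (x t, jet u L t) + D * iteratedDeriv i u t := by
    intro i
    induction i with
    | zero =>
      intro _ t ht
      simpa [stateJet] using hy t ht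
    | succ i ih =>
      intro hi t ht
      have h1 : iteratedDeriv i y =ᶠ[𝓝 t] fun t =>
          C ⬝ᵥ stateJet A B L i (x t, jet u L t) + D * iteratedDeriv i u t :=
        Filter.eventuallyEq_of_mem (hU.mem_nhds ht) (ih (Nat.lt_of_succ_lt hi))
      rw [iteratedDeriv_succ, h1.deriv_eq, iteratedDeriv_succ]
      exact ((hasDerivAt_dotProduct C (hasDerivAt_stateJet (fun k => hu k t ht) (hx t ht) i
        (Nat.lt_of_succ_lt hi))).add ((hu i t ht).hasDerivAt.const_mul D)).deriv
  intro t ht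
  funext i
  rcases i with i | i
  · rfl
  · rw [jetMap_inr]
    exact key i i.2 t ht

theorem ioJets_eq_range (A : Matrix (Fin n) (Fin n) ℝ) (B C : Fin n → ℝ) (D : ℝ) (L : ℕ) :
    ioJets A B C D L = Set.range (jetMap A B C D L) := by
  have hsm : ∀ {u : ℝ → ℝ}, ContDiff ℝ ∞ u → ∀ k t, DifferentiableAt ℝ (iteratedDeriv k u) t :=
    fun hu k t => hu.differentiable_iteratedDeriv k (by exact_mod_cast ENat.natCast_lt_top k) t
  ext v
  constructor
  · rintro ⟨t₀, u, y, x, hu, hev, rfl⟩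
    obtain ⟨U, hU, hUo, ht₀⟩ := eventually_nhds_iff.1 hev
    exact ⟨_, (ioJet_eq_jetMap L hUo (fun k t _ => hsm hu k t) (fun t ht => (hU t ht).1)
      (fun t ht => (hU t ht).2) t₀ ht₀).symm⟩
  · rintro ⟨⟨x₀, v⟩, rfl⟩
    obtain ⟨u, hu, huv⟩ := exists_smooth_jet L v
    obtain ⟨x, hx0, hx⟩ := exists_state A B hu.continuous x₀
    refine ⟨0, u, fun t => C ⬝ᵥ x t + D * u t, x, hu, .of_forall fun t => ⟨hx t, rfl⟩, ?_⟩
    rw [ioJet_eq_jetMap L isOpen_univ (fun k t _ => hsm hu k t) (fun t _ => hx t)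
      (fun t _ => rfl) 0 (mem_univ _), huv, hx0]

theorem hankel_mulVec (u y : ℝ → ℝ) (L : ℕ) {k : ℕ} (τ : Fin k → ℝ) (a : Fin k → ℝ) :
    hankel u y L τ *ᵥ a = ∑ j, a j • ioJet u y L (τ j) := by
  funext i
  simp [mulVec, dotProduct, hankel, mul_comm]

/-- `hspan` is spanning in dual form; finite dimension then reduces the whole interval to finitely
many instants. -/
theorem informative_of_span {A : Matrix (Fin n) (Fin n) ℝ} {B C : Fin n → ℝ} {D : ℝ} {L : ℕ}
    {T : ℝ} {u y : ℝ → ℝ} {x : ℝ → Fin n → ℝ}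
    (hio : ∀ t ∈ Ioo 0 T, ioJet u y L t = jetMap A B C D L (x t, jet u L t))
    (hspan : ∀ (η : Fin n → ℝ) (ν : Fin L → ℝ),
      (∀ t ∈ Ioo 0 T, η ⬝ᵥ x t + ν ⬝ᵥ jet u L t = 0) → η = 0 ∧ ν = 0) :
    Informative A B C D L T u y := by
  let s : Set ((Fin n → ℝ) × (Fin L → ℝ)) := (fun t => (x t, jet u L t)) '' Ioo 0 T
  have htop : Submodule.span ℝ s = ⊤ := by
    by_contra hne
    obtain ⟨φ, hφ, hle⟩ := Submodule.exists_le_ker_of_lt_top _ (lt_top_iff_ne_top.2 hne)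
    have h1 : ∀ p : (Fin n → ℝ) × (Fin L → ℝ), φ p =
        (dotProductEquiv ℝ (Fin n)).symm (φ ∘ₗ LinearMap.inl ℝ _ _) ⬝ᵥ p.1 +
        (dotProductEquiv ℝ (Fin L)).symm (φ ∘ₗ LinearMap.inr ℝ _ _) ⬝ᵥ p.2 := by
      intro p
      have h2 := LinearMap.congr_fun ((dotProductEquiv ℝ (Fin n)).apply_symm_apply
        (φ ∘ₗ LinearMap.inl ℝ _ _)) p.1
      have h3 := LinearMap.congr_fun ((dotProductEquiv ℝ (Fin L)).apply_symm_apply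
        (φ ∘ₗ LinearMap.inr ℝ _ _)) p.2
      rw [dotProductEquiv_apply_apply] at h2 h3
      rw [h2, h3]
      simp [← map_add]
    obtain ⟨hη, hν⟩ := hspan _ _ fun t ht =>
      (h1 (x t, jet u L t)).symm.trans (hle (Submodule.subset_span ⟨t, ht, rfl⟩))
    refine hφ (LinearMap.ext fun p => ?_)
    rw [h1, hη, hν]
    simp
  -- A finite spanning family chosen inside `s` itself supplies the sampling instants.
  obtain ⟨f, hfs, hf, -⟩ := Submodule.exists_fun_fin_finrank_span_eq ℝ s
  choose τ hτ hτf using hfs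
  refine ⟨_, τ, hτ, ?_⟩
  have hcol : ∀ a, hankel u y L τ *ᵥ a = jetMap A B C D L (∑ j, a j • f j) := by
    intro a
    rw [hankel_mulVec, map_sum]
    refine Finset.sum_congr rfl fun j _ => ?_
    rw [hio _ (hτ j), map_smul, ← hτf j]
  rw [ioJets_eq_range]
  ext v
  constructor
  · rintro ⟨a, rfl⟩
    exact ⟨_, (hcol a).symm⟩
  · rintro ⟨p, rfl⟩
    have hp : p ∈ Submodule.span ℝ (Set.range f) := by rw [hf, htop]; trivial
    obtain ⟨a, rfl⟩ := (Submodule.mem_span_range_iff_exists_fun ℝ).1 hp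
    exact ⟨a, hcol a⟩

theorem not_informative_of_annihilator {A : Matrix (Fin n) (Fin n) ℝ} {B C : Fin n → ℝ} {D : ℝ}
    {L : ℕ} {T : ℝ} {u y : ℝ → ℝ} (φ : (Fin L ⊕ Fin L → ℝ) →ₗ[ℝ] ℝ)
    (hφ : ∀ t ∈ Ioo 0 T, φ (ioJet u y L t) = 0) {p : (Fin n → ℝ) × (Fin L → ℝ)}
    (hp : φ (jetMap A B C D L p) ≠ 0) : ¬ Informative A B C D L T u y := by
  rintro ⟨k, τ, hτ, hr⟩
  have hmem : jetMap A B C D L p ∈ ioJets A B C D L := by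
    rw [ioJets_eq_range]
    exact mem_range_self p
  rw [← hr] at hmem
  obtain ⟨a, ha⟩ := hmem
  refine hp ?_
  rw [← ha]
  change φ (hankel u y L τ *ᵥ a) = 0
  rw [hankel_mulVec, map_sum]
  exact Finset.sum_eq_zero fun j _ => by rw [map_smul, hφ _ (hτ j), smul_zero]

end Jets

/-! ### Lebesgue-null sets of uncontrollable vectors -/

section Null

variable {n : ℕ}

theorem ctrb_add_smul (k : ℕ) (A : Matrix (Fin n) (Fin n) ℝ) (b c : Fin n → ℝ) (t : ℝ) :
    ctrb k A (b + t • c) = t • ctrb k A c + ctrb k A b := by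
  ext i j
  simp [ctrb, mulVec_add, mulVec_smul, add_comm]

theorem continuous_ctrb (k : ℕ) (A : Matrix (Fin n) (Fin n) ℝ) : Continuous (ctrb k A) :=
  continuous_pi fun _ => continuous_pi fun _ =>
    (continuous_apply _).comp (continuous_const.matrix_mulVec continuous_id)

open Polynomial in
-- The determinant is a polynomial in `t` whose coefficient of `t^n` is `det M`.
theorem finite_det_smul_add_eq_zero {M : Matrix (Fin n) (Fin n) ℝ} (hM : M.det ≠ 0)
    (R : Matrix (Fin n) (Fin n) ℝ) : {t : ℝ | (t • M + R).det = 0}.Finite := by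
  set p : ℝ[X] := det ((X : ℝ[X]) • M.map C + R.map C) with hp
  have hp0 : p ≠ 0 := by
    intro h0
    have := coeff_det_X_add_C_card M R
    rw [← hp, h0, coeff_zero] at this
    exact hM this.symm
  refine (p.roots.toFinset.finite_toSet).subset fun t ht => ?_
  rw [Finset.mem_coe, Multiset.mem_toFinset, mem_roots hp0, IsRoot.def, hp, ← coe_evalRingHom,
    RingHom.map_det]
  refine Eq.trans (congrArg det ?_) ht
  ext i j
  simp [mul_comm t]

/-- If some `(A, B)` is controllable, then `(A, ξ)` is for almost every `ξ`. -/
theorem volume_rank_ctrb_lt {A : Matrix (Fin n) (Fin n) ℝ} {B : Fin n → ℝ}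
    (hAB : Controllable A B) : volume {ξ : Fin n → ℝ | (ctrb n A ξ).rank < n} = 0 := by
  have hdet : ∀ ξ, (ctrb n A ξ).rank < n ↔ (ctrb n A ξ).det = 0 := fun ξ => by
    rw [rank_lt_iff_vecMul, ← exists_vecMul_eq_zero_iff]
  have hc : Continuous fun ξ => (ctrb n A ξ).det := (continuous_ctrb n A).matrix_det
  have hB : (ctrb n A B).det ≠ 0 := fun h => ((hdet B).2 h).ne hAB
  have hae : ∀ᵐ ξ : Fin n → ℝ, ξ ∈ {ξ : Fin n → ℝ | (ctrb n A ξ).det ≠ 0} := by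
    -- It suffices to argue along lines parallel to `B`: each meets the zero set of the determinant
    -- in finitely many points.
    refine ae_mem_of_ae_add_linearMap_mem (LinearMap.toSpanSingleton ℝ (Fin n → ℝ) B)
      (volume : Measure ℝ) volume (isOpen_ne.preimage hc).measurableSet fun ξ => ?_
    have hfin := finite_det_smul_add_eq_zero hB (ctrb n A ξ)
    filter_upwards [hfin.measure_zero volume |> compl_mem_ae_iff.2] with t ht
    rw [LinearMap.toSpanSingleton_apply, ctrb_add_smul]
    exact ht
  rw [ae_iff] at hae
  simpa [hdet] using hae

end Null

end CTFL

namespace CTFL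

/-! ### The exceptional set and data produced by the generator -/

section Generator

variable {n N : ℕ}

theorem vecMul_obsv_castLE {L : ℕ} (hL : L ≤ N) (c : Fin N → ℝ) (S : Matrix (Fin N) (Fin N) ℝ)
    {b : Fin N → ℝ} (hb : ∀ j : Fin N, L ≤ (j : ℕ) → b j = 0) :
    b ᵥ* obsv N c S = (fun j : Fin L => b (Fin.castLE hL j)) ᵥ* obsv L c S := by
  rw [vecMul_obsv, vecMul_obsv]
  have h1 := Finset.sum_map Finset.univ (Fin.castLEEmb hL) fun j => b j • (c ᵥ* S ^ (j : ℕ))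
  refine Eq.trans (Finset.sum_subset (Finset.subset_univ _) fun j _ hj => ?_).symm h1
  rw [hb j, zero_smul]
  by_contra! hlt
  exact hj (Finset.mem_map.2 ⟨⟨j, hlt⟩, Finset.mem_univ _, rfl⟩)

theorem exists_extend_vecMul_obsv {L : ℕ} (hL : L ≤ N) (c : Fin N → ℝ)
    (S : Matrix (Fin N) (Fin N) ℝ) (a : Fin L → ℝ) :
    ∃ b : Fin N → ℝ, (∀ j : Fin N, L ≤ (j : ℕ) → b j = 0) ∧
      (fun j : Fin L => b (Fin.castLE hL j)) = a ∧ b ᵥ* obsv N c S = a ᵥ* obsv L c S := by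
  let b : Fin N → ℝ := fun j => if h : (j : ℕ) < L then a ⟨j, h⟩ else 0
  have hb : ∀ j : Fin N, L ≤ (j : ℕ) → b j = 0 := fun j hj => dif_neg hj.not_gt
  have hba : (fun j : Fin L => b (Fin.castLE hL j)) = a := funext fun j => dif_pos j.2
  exact ⟨b, hb, hba, by rw [vecMul_obsv_castLE hL c S hb, hba]⟩

theorem Observable.eq_zero_of_vecMul_obsv_le {S : Matrix (Fin N) (Fin N) ℝ} {c : Fin N → ℝ}
    (h : Observable c S) {L : ℕ} (hL : L ≤ N) {a : Fin L → ℝ} (ha : a ᵥ* obsv L c S = 0) :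
    a = 0 := by
  obtain ⟨b, -, hba, hb⟩ := exists_extend_vecMul_obsv hL c S a
  rw [← hba, h.eq_zero_of_vecMul (hb.trans ha)]
  rfl

theorem vecMul_dropCols_eq_zero_iff {m L : ℕ} (M : Matrix (Fin m) (Fin N) ℝ) (η : Fin m → ℝ) :
    η ᵥ* dropCols L M = 0 ↔ ∀ j : Fin N, L ≤ (j : ℕ) → (η ᵥ* M) j = 0 := by
  constructor
  · intro h j hj
    have := congrFun h ⟨(j : ℕ) - L, by omega⟩
    have hj' : (⟨L + ((j : ℕ) - L), by omega⟩ : Fin N) = j := Fin.ext (by simp; omega)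
    rw [← hj']
    exact this
  · intro h
    exact funext fun j => h ⟨L + (j : ℕ), by omega⟩ (Nat.le_add_right _ _)

/-- A row combination of `P` has vanishing last coordinates with respect to the rows of the
observability matrix iff it is a combination of the first `L` of these rows. -/
theorem vecMul_dropCols_mul_inv_eq_zero_iff {S : Matrix (Fin N) (Fin N) ℝ} {c : Fin N → ℝ}
    (h : Observable c S) {L : ℕ} (hL : L ≤ N) (P : Matrix (Fin n) (Fin N) ℝ) (η : Fin n → ℝ) :
    η ᵥ* dropCols L (P * (obsv N c S)⁻¹) = 0 ↔
      ∃ a : Fin L → ℝ, η ᵥ* P = a ᵥ* obsv L c S := by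
  rw [vecMul_dropCols_eq_zero_iff]
  constructor
  · intro hz
    refine ⟨fun j => (η ᵥ* (P * (obsv N c S)⁻¹)) (Fin.castLE hL j), ?_⟩
    rw [← vecMul_obsv_castLE hL c S hz, vecMul_vecMul, Matrix.mul_assoc,
      nonsing_inv_mul _ h.isUnit_det, Matrix.mul_one]
  · rintro ⟨a, ha⟩
    obtain ⟨b, hb0, -, hb⟩ := exists_extend_vecMul_obsv hL c S a
    rw [← vecMul_vecMul, ha, ← hb, vecMul_vecMul, mul_nonsing_inv _ h.isUnit_det, vecMul_one]
    exact hb0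

/-- The rank defect is tested on left null vectors `η`: Cayley–Hamilton extends the first block to
all powers, and the second block says that `η P` lies in the row span of `obsv L l S`. -/
theorem mem_exceptionalSet_iff {A : Matrix (Fin n) (Fin n) ℝ} {B : Fin n → ℝ}
    {S : Matrix (Fin N) (Fin N) ℝ} {l w₀ : Fin N → ℝ} {L : ℕ} (hlS : Observable l S)
    (hσ : cspec A ∩ cspec S = ∅) (hL : L ≤ N) {P : Matrix (Fin n) (Fin N) ℝ}
    (hP : A * P + vecMulVec B l = P * S) {x₀ : Fin n → ℝ} :
    x₀ ∈ exceptionalSet A B S l w₀ L ↔ ∃ η : Fin n → ℝ, η ≠ 0 ∧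
      (∀ k, η ⬝ᵥ (A ^ k *ᵥ (x₀ - P *ᵥ w₀)) = 0) ∧ ∃ a : Fin L → ℝ, η ᵥ* P = a ᵥ* obsv L l S := by
  have h1 : x₀ ∈ exceptionalSet A B S l w₀ L ↔
      (fromCols (ctrb n A (x₀ - P *ᵥ w₀)) (dropCols L (P * (obsv N l S)⁻¹))).rank < n := by
    constructor
    · rintro ⟨Q, hQ, hr⟩
      rwa [(existsUnique_sylvester hσ _).unique hP hQ]
    · exact fun hr => ⟨P, hP, hr⟩
  rw [h1, rank_lt_iff_vecMul]
  refine exists_congr fun η => and_congr_right fun _ => ?_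
  rw [vecMul_fromCols, ← vecMul_dropCols_mul_inv_eq_zero_iff hlS hL]
  constructor
  · intro h
    refine ⟨dotProduct_pow_mulVec_eq_zero A η _ fun j hj => ?_, ?_⟩
    · exact congrFun h (Sum.inl ⟨j, hj⟩)
    · exact funext fun j => congrFun h (Sum.inr j)
  · rintro ⟨h, h'⟩
    rw [h']
    funext j
    rcases j with j | j
    · exact h j
    · rfl

/-- At `x₀ = P w₀` the transient vanishes, leaving only `N - L < n` possibly nonzero columns. -/
theorem exceptionalSet_nonempty {A : Matrix (Fin n) (Fin n) ℝ} {B : Fin n → ℝ}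
    {S : Matrix (Fin N) (Fin N) ℝ} {l : Fin N → ℝ} (w₀ : Fin N → ℝ) {L : ℕ}
    (hσ : cspec A ∩ cspec S = ∅) (hL : L ≤ N) (hN : N < L + n) :
    (exceptionalSet A B S l w₀ L).Nonempty := by
  obtain ⟨P, hP, -⟩ := existsUnique_sylvester hσ (vecMulVec B l)
  refine ⟨P *ᵥ w₀, P, hP, ?_⟩
  have h2 : (dropCols L (P * (obsv N l S)⁻¹)).rank < n :=
    (rank_le_width _).trans_lt (by omega)
  obtain ⟨η, hη, h0⟩ := (rank_lt_iff_vecMul _).1 h2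
  refine (rank_lt_iff_vecMul _).2 ⟨η, hη, ?_⟩
  rw [vecMul_fromCols, h0]
  funext j
  rcases j with j | j
  · change η ⬝ᵥ (A ^ (j : ℕ) *ᵥ (P *ᵥ w₀ - P *ᵥ w₀)) = 0
    simp
  · rfl

/-- The first block alone must already be rank deficient, so the set lies in a translate of a null
set. -/
theorem volume_exceptionalSet {A : Matrix (Fin n) (Fin n) ℝ} {B : Fin n → ℝ}
    {S : Matrix (Fin N) (Fin N) ℝ} {l : Fin N → ℝ} (w₀ : Fin N → ℝ) {L : ℕ}
    (hAB : Controllable A B) (hlS : Observable l S) (hσ : cspec A ∩ cspec S = ∅) (hL : L ≤ N) :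
    volume (exceptionalSet A B S l w₀ L) = 0 := by
  obtain ⟨P, hP, -⟩ := existsUnique_sylvester hσ (vecMulVec B l)
  refine measure_mono_null (t := (fun x => x - P *ᵥ w₀) ⁻¹' {ξ | (ctrb n A ξ).rank < n})
    (fun x₀ hx₀ => ?_) ?_
  · obtain ⟨η, hη, h0, -⟩ := (mem_exceptionalSet_iff hlS hσ hL hP).1 hx₀
    exact (rank_lt_iff_vecMul _).2 ⟨η, hη, funext fun j => h0 j⟩
  · simp only [sub_eq_add_neg]
    rw [measure_preimage_add_right]
    exact volume_rank_ctrb_lt hAB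

/-- What input–output data of the interconnection amount to, once the steady-state response `P w`
is split off the state. -/
theorem IsData.exists_split {A : Matrix (Fin n) (Fin n) ℝ} {B C : Fin n → ℝ} {D : ℝ}
    {S : Matrix (Fin N) (Fin N) ℝ} {l w₀ : Fin N → ℝ} {T : ℝ} {x₀ : Fin n → ℝ} {u y : ℝ → ℝ}
    (h : IsData A B C D S l w₀ T x₀ u y) {P : Matrix (Fin n) (Fin N) ℝ}
    (hP : A * P + vecMulVec B l = P * S) (L : ℕ) :
    ∃ (w : ℝ → Fin N → ℝ) (z : ℝ → Fin n → ℝ), w 0 = w₀ ∧ z 0 = x₀ - P *ᵥ w₀ ∧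
      (∀ t ∈ Icc 0 T, HasDerivWithinAt w (S *ᵥ w t) (Icc 0 T) t) ∧
      (∀ t ∈ Icc 0 T, HasDerivWithinAt z (A *ᵥ z t) (Icc 0 T) t) ∧
      (∀ t ∈ Ioo 0 T, jet u L t = obsv L l S *ᵥ w t) ∧
      ∀ t ∈ Ioo 0 T, ioJet u y L t = jetMap A B C D L (z t + P *ᵥ w t, jet u L t) := by
  obtain ⟨w, x, hw0, hx0, hd⟩ := h
  have hw : ∀ t ∈ Ioo 0 T, HasDerivAt w (S *ᵥ w t) t := fun t ht =>
    (hd t (Ioo_subset_Icc_self ht)).1.hasDerivAt (Icc_mem_nhds ht.1 ht.2)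
  have hu : ∀ k, ∀ t ∈ Ioo 0 T, iteratedDeriv k u t = l ⬝ᵥ (S ^ k *ᵥ w t) := by
    intro k
    induction k with
    | zero =>
      intro t ht
      simpa using (hd t (Ioo_subset_Icc_self ht)).2.1
    | succ k ih =>
      intro t ht
      have h1 : iteratedDeriv k u =ᶠ[𝓝 t] fun t => (l ᵥ* S ^ k) ⬝ᵥ w t :=
        Filter.eventuallyEq_of_mem (Ioo_mem_nhds ht.1 ht.2) fun s hs => by
          rw [ih s hs, dotProduct_mulVec]
      rw [iteratedDeriv_succ, h1.deriv_eq, (hasDerivAt_dotProduct _ (hw t ht)).deriv,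
        ← dotProduct_mulVec, mulVec_mulVec, ← pow_succ]
  have hdiff : ∀ k, ∀ t ∈ Ioo 0 T, DifferentiableAt ℝ (iteratedDeriv k u) t := by
    intro k t ht
    have h1 : iteratedDeriv k u =ᶠ[𝓝 t] fun t => (l ᵥ* S ^ k) ⬝ᵥ w t :=
      Filter.eventuallyEq_of_mem (Ioo_mem_nhds ht.1 ht.2) fun s hs => by
        rw [hu k s hs, dotProduct_mulVec]
    exact ((hasDerivAt_dotProduct _ (hw t ht)).congr_of_eventuallyEq h1).differentiableAt
  refine ⟨w, fun t => x t - P *ᵥ w t, hw0, by simp only [hx0, hw0], fun t ht => (hd t ht).1,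
    fun t ht => ?_, fun t ht => funext fun i => ?_, fun t ht => ?_⟩
  · obtain ⟨hw, hut, hx, -⟩ := hd t ht
    have h1 := hx.sub (hasDerivWithinAt_linearMap P.mulVecLin hw)
    have h2 : u t • B = vecMulVec B l *ᵥ w t := by
      rw [hut, vecMulVec_mulVec, op_smul_eq_smul]
    -- Sylvester's equation makes the input cancel, so the transient is autonomous.
    have h3 : A *ᵥ x t + u t • B - P.mulVecLin (S *ᵥ w t) = A *ᵥ (x t - P *ᵥ w t) := by
      rw [mulVecLin_apply, mulVec_mulVec, ← hP, h2, add_mulVec, mulVec_sub, mulVec_mulVec]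
      abel
    rw [h3] at h1
    exact h1
  · rw [obsv_mulVec_apply]
    exact hu i t ht
  · rw [sub_add_cancel]
    refine ioJet_eq_jetMap L isOpen_Ioo hdiff (fun t ht => ?_) (fun t ht => ?_) t ht
    · exact (hd t (Ioo_subset_Icc_self ht)).2.2.1.hasDerivAt (Icc_mem_nhds ht.1 ht.2)
    · exact (hd t (Ioo_subset_Icc_self ht)).2.2.2

/-- Data are informative as soon as no nonzero row vector annihilates both the transient Krylov
space and the steady-state response modulo the input jets. -/
theorem IsData.informative {A : Matrix (Fin n) (Fin n) ℝ} {B C : Fin n → ℝ} {D : ℝ}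
    {S : Matrix (Fin N) (Fin N) ℝ} {l w₀ : Fin N → ℝ} {T : ℝ} {x₀ : Fin n → ℝ} {u y : ℝ → ℝ}
    (h : IsData A B C D S l w₀ T x₀ u y) (hlS : Observable l S) (hSw : Controllable S w₀)
    (hσ : cspec A ∩ cspec S = ∅) (hT : 0 < T) {L : ℕ} (hL : L ≤ N)
    {P : Matrix (Fin n) (Fin N) ℝ} (hP : A * P + vecMulVec B l = P * S)
    (h0 : ∀ (η : Fin n → ℝ) (a : Fin L → ℝ), (∀ k, η ⬝ᵥ (A ^ k *ᵥ (x₀ - P *ᵥ w₀)) = 0) →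
      η ᵥ* P = a ᵥ* obsv L l S → η = 0) : Informative A B C D L T u y := by
  obtain ⟨w, z, hw0, hz0, hw, hz, hjet, hio⟩ := h.exists_split hP L
  refine informative_of_span hio fun η ν hην => ?_
  obtain ⟨hμ, hk⟩ := eq_zero_and_pow_eq_zero hσ hT hz hw (hw0 ▸ hSw) (η := η)
    (μ := η ᵥ* P + ν ᵥ* obsv L l S) fun t ht => by
      have := hην t ht
      rwa [hjet t ht, dotProduct_add, dotProduct_mulVec, dotProduct_mulVec, add_assoc,
        ← add_dotProduct] at this
  rw [hz0] at hk
  have hη : η = 0 := h0 η (-ν) hk (by rw [neg_vecMul]; exact eq_neg_of_add_eq_zero_left hμ)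
  rw [hη, zero_vecMul, zero_add] at hμ
  exact ⟨hη, hlS.eq_zero_of_vecMul_obsv_le hL hμ⟩

theorem IsData.not_informative_of_lt {A : Matrix (Fin n) (Fin n) ℝ} {B C : Fin n → ℝ} {D : ℝ}
    {S : Matrix (Fin N) (Fin N) ℝ} {l w₀ : Fin N → ℝ} {T : ℝ} {x₀ : Fin n → ℝ} {u y : ℝ → ℝ}
    (h : IsData A B C D S l w₀ T x₀ u y) (hσ : cspec A ∩ cspec S = ∅) {L : ℕ} (hL : N < L) :
    ¬ Informative A B C D L T u y := by
  obtain ⟨P, hP, -⟩ := existsUnique_sylvester hσ (vecMulVec B l)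
  obtain ⟨w, z, -, -, -, -, hjet, -⟩ := h.exists_split hP L
  obtain ⟨ν, hν, h0⟩ := (rank_lt_iff_vecMul (obsv L l S)).1 ((rank_le_width _).trans_lt hL)
  -- Since `N < L`, some `ν ≠ 0` kills all observed input jets, while the admissible input jet `ν`
  -- gives `ν ⬝ᵥ ν ≠ 0`.
  refine not_informative_of_annihilator
    (dotProductBilin ℝ ℝ ν ∘ₗ LinearMap.funLeft ℝ ℝ Sum.inl) (fun t ht => ?_) (p := (0, ν)) ?_
  · change ν ⬝ᵥ jet u L t = 0
    rw [hjet t ht, dotProduct_mulVec, h0, zero_dotProduct]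
  · change ν ⬝ᵥ ν ≠ 0
    rwa [Ne, dotProduct_self_eq_zero]

theorem IsData.not_informative_of_annihilator {A : Matrix (Fin n) (Fin n) ℝ} {B C : Fin n → ℝ}
    {D : ℝ} {S : Matrix (Fin N) (Fin N) ℝ} {l w₀ : Fin N → ℝ} {T : ℝ} {x₀ : Fin n → ℝ}
    {u y : ℝ → ℝ} (h : IsData A B C D S l w₀ T x₀ u y) (hCA : Observable C A) {L : ℕ}
    (hL : n ≤ L) {P : Matrix (Fin n) (Fin N) ℝ} (hP : A * P + vecMulVec B l = P * S)
    {η : Fin n → ℝ} (hη : η ≠ 0) (hk : ∀ k, η ⬝ᵥ (A ^ k *ᵥ (x₀ - P *ᵥ w₀)) = 0)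
    {a : Fin L → ℝ} (ha : η ᵥ* P = a ᵥ* obsv L l S) : ¬ Informative A B C D L T u y := by
  obtain ⟨w, z, hw0, hz0, hw, hz, hjet, hio⟩ := h.exists_split hP L
  have hηz := dotProduct_eq_zero_of_hasDerivWithinAt A hz (η := η) (by rwa [hz0])
  -- A left inverse of `jetMap` recovers state and input jet from the input–output jet, so `η x - a
  -- u` is a functional of the latter. On the data it equals `η z = 0`; at the pair `(η, 0)` it is
  -- `η ⬝ᵥ η`.
  obtain ⟨g, hg⟩ := LinearMap.exists_leftInverse_of_injective (jetMap A B C D L)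
    (LinearMap.ker_eq_bot.2 (jetMap_injective B D hCA hL))
  have hg' : ∀ p, g (jetMap A B C D L p) = p := LinearMap.congr_fun hg
  let ψ : (Fin n → ℝ) × (Fin L → ℝ) →ₗ[ℝ] ℝ :=
    (dotProductBilin ℝ ℝ η).coprod (-dotProductBilin ℝ ℝ a)
  have hψ : ∀ p, ψ p = η ⬝ᵥ p.1 + -(a ⬝ᵥ p.2) := fun _ => rfl
  refine CTFL.not_informative_of_annihilator (ψ ∘ₗ g) (fun t ht => ?_) (p := (η, 0)) ?_
  · rw [LinearMap.comp_apply, hio t ht, hg', hψ, hjet t ht, dotProduct_add,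
      hηz t (Ioo_subset_Icc_self ht), dotProduct_mulVec, dotProduct_mulVec, ha, zero_add,
      add_neg_cancel]
  · rw [LinearMap.comp_apply, hg', hψ, dotProduct_zero, neg_zero, add_zero, Ne,
      dotProduct_self_eq_zero]
    exact hη

open Polynomial in
theorem exists_polynomial_vecMul_obsv (S : Matrix (Fin N) (Fin N) ℝ) (l : Fin N → ℝ) {L : ℕ}
    (a : Fin L → ℝ) : ∃ p : ℝ[X], (∀ i, L ≤ i → p.coeff i = 0) ∧
      a ᵥ* obsv L l S = l ᵥ* aeval S p := by
  refine ⟨∑ j : Fin L, monomial (j : ℕ) (a j), fun i hi => ?_, ?_⟩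
  · rw [finsetSum_coeff]
    exact Finset.sum_eq_zero fun j _ => coeff_monomial_of_ne _ (by omega)
  · rw [vecMul_obsv, map_sum, vecMul_sum]
    refine Finset.sum_congr rfl fun j _ => ?_
    rw [aeval_monomial, Algebra.algebraMap_eq_smul_one, Matrix.smul_mul, Matrix.one_mul,
      vecMul_smul]

end Generator

end CTFL

theorem theorem2 {n N : ℕ} (A : Matrix (Fin n) (Fin n) ℝ) (B C : Fin n → ℝ) (D : ℝ)
    (Sg : Matrix (Fin N) (Fin N) ℝ) (Lg w₀ : Fin N → ℝ)
    (hAB : CTFL.Controllable A B) (hCA : CTFL.Observable C A)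
    (hLS : CTFL.Observable Lg Sg) (hSw : CTFL.Controllable Sg w₀)
    (hσ : CTFL.cspec A ∩ CTFL.cspec Sg = ∅)
    (T : ℝ) (hT : 0 < T) (L : ℕ) :
    -- (a) too small a generator: never informative
    (N < L → ∀ (x₀ : Fin n → ℝ) (u y : ℝ → ℝ),
      CTFL.IsData A B C D Sg Lg w₀ T x₀ u y → ¬ CTFL.Informative A B C D L T u y) ∧
    -- (b) informative off the nonempty Lebesgue-null exceptional set, which is exact for `n ≤ L`
    (L ≤ N → N < L + n →
      (CTFL.exceptionalSet A B Sg Lg w₀ L).Nonempty ∧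
      MeasureTheory.volume (CTFL.exceptionalSet A B Sg Lg w₀ L) = 0 ∧
      (∀ x₀ ∉ CTFL.exceptionalSet A B Sg Lg w₀ L, ∀ u y : ℝ → ℝ,
        CTFL.IsData A B C D Sg Lg w₀ T x₀ u y → CTFL.Informative A B C D L T u y) ∧
      (n ≤ L → ∀ x₀ ∈ CTFL.exceptionalSet A B Sg Lg w₀ L, ∀ u y : ℝ → ℝ,
        CTFL.IsData A B C D Sg Lg w₀ T x₀ u y → ¬ CTFL.Informative A B C D L T u y)) ∧
    -- (c) large enough a generator: always informative
    (L + n ≤ N → ∀ (x₀ : Fin n → ℝ) (u y : ℝ → ℝ),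
      CTFL.IsData A B C D Sg Lg w₀ T x₀ u y → CTFL.Informative A B C D L T u y) := by
  obtain ⟨P, hP, -⟩ := CTFL.existsUnique_sylvester hσ (Matrix.vecMulVec B Lg)
  refine ⟨fun hN x₀ u y h => h.not_informative_of_lt hσ hN, fun hL hN =>
    ⟨CTFL.exceptionalSet_nonempty w₀ hσ hL hN, CTFL.volume_exceptionalSet w₀ hAB hLS hσ hL,
      fun x₀ hx₀ u y h => ?_, fun hn x₀ hx₀ u y h => ?_⟩, fun hN x₀ u y h => ?_⟩
  · refine h.informative hLS hSw hσ hT hL hP fun η a hk ha => ?_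
    by_contra hη
    exact hx₀ ((CTFL.mem_exceptionalSet_iff hLS hσ hL hP).2 ⟨η, hη, hk, a, ha⟩)
  · obtain ⟨η, hη, hk, a, ha⟩ := (CTFL.mem_exceptionalSet_iff hLS hσ hL hP).1 hx₀
    exact h.not_informative_of_annihilator hCA hn hP hη hk ha
  -- The transient condition is discarded: the steady-state condition already forces `η = 0`,
  -- whatever `x₀` is.
  · refine h.informative hLS hSw hσ hT (by omega) hP fun η a _ ha => ?_
    obtain ⟨p, hdeg, hp⟩ := CTFL.exists_polynomial_vecMul_obsv Sg Lg a
    exact CTFL.eq_zero_of_vecMul_sylvester_eq hAB hLS hP hN hdeg (ha.trans hp)
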